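/- **Setting.** A non-commutative $*$-probability space is a pair $(A,\varphi)$ where $A$ is a complex unital $*$-algebra and $\varphi:A\to\mathbb{C}$ is a unital linear map with $\varphi(a^*a)\ge 0$ for all $a\in A$. For $\chi\in\{l,r\}^n$ with $\chi^{-1}(l)=\{i_1<\dots<i_m\}$ and $\chi^{-1}(r)=\{j_1<\dots<j_{n-m}\}$, let $s_\chi$ be the permutation of $\{1,\dots,n\}$ with $(s_\chi(1),\dots,s_\chi(n))=(i_1,\dots,i_m,j_{n-m},\dots,j_1)$, and write $i\prec_\chi j$ if $s_\chi^{-1}(i)<s_\chi^{-1}(j)$. A partition $\tau$ of $\{1,\dots,n\}$ is bi-non-crossing with respect to $\chi$ if, whenever $V,W$ are blocks of $\tau$ and $v_1,v_2\in V$, $w_1,w_2\in W$ satisfy $v_1\prec_\chi w_1\prec_\chi v_2\prec_\chi w_2$, then $V=W$. Let $BNC(\chi)$ be the set of these partitions, ordered by refinement, let $\mu_{BNC}$ be its Möbius function and $1_\chi$ its largest element. For a partition $\lambda$ of $\{1,\dots,n\}$ put $\varphi_\lambda(a_1,\dots,a_n)=\prod_{V\in\lambda}\varphi(a_{v_1}\cdots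 a_{v_k})$, where $V=\{v_1<\dots<v_k\}$. The bi-free cumulants are $$\kappa_\chi(a_1,\dots,a_n)=\sum_{\lambda\in BNC(\chi)}\varphi_\lambda(a_1,\dots,a_n)\,\mu_{BNC}(\lambda,1_\chi).$$ A pair $(X,Y)$ of elements of $A$ is *bi-R-diagonal* if for every $n\in\mathbb{N}$, every $\chi\in\{l,r\}^n$ and every choice of labels $\varepsilon_1,\dots,\varepsilon_n\in\{1,*\}$, the elements $a_i=X^{\varepsilon_i}$ (if $\chi(i)=l$) and $a_i=Y^{\varepsilon_i}$ (if $\chi(i)=r$), with $X^1=X$ and $Y^1=Y$, satisfy: 1. $\kappa_\chi(a_1,\dots,a_n)=0$ if $n$ is odd; 2. $\kappa_\chi(a_1,\dots,a_n)=0$ if $n$ is even and the sequence of labels $(\varepsilon_{s_\chi(1)},\dots,\varepsilon_{s_\chi(n)})$ is not alternating, i.e. two consecutive labels in it are equal. **Theorem.** Let $(A,\varphi)$ be a non-commutative $*$-probability space and let $(X,Y)$ be a bi-R-diagonal pair in $A$. Then for every integer $p\ge 1$ the pair $(X^p,Y^p)$ is also bi-R-diagonal. -/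

import Mathlib

namespace BiFree

/-- A state of a non-commutative `*`-probability space `(A, φ)`: a unital linear functional with
`φ (a* a) ≥ 0` for all `a` (that is, `φ (a* a)` is a non-negative real number). -/
structure IsState {A : Type*} [Ring A] [StarRing A] [Algebra ℂ A] (φ : A →ₗ[ℂ] ℂ) : Prop where
  map_one : φ 1 = 1
  nonneg_re : ∀ a : A, 0 ≤ (φ (star a * a)).re
  im_eq_zero : ∀ a : A, (φ (star a * a)).im = 0

/-- The two labels: left and right. -/
inductive Side : Type
  | l : Side
  | r : Side
  deriving DecidableEq

/-- The indices labelled `l` in increasing order, followed by the indices labelled `r` in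
decreasing order. -/
def chiList {n : ℕ} (χ : Fin n → Side) : List (Fin n) :=
  (List.finRange n).filter (fun i => χ i = Side.l) ++
    ((List.finRange n).filter (fun i => χ i = Side.r)).reverse

theorem mem_chiList {n : ℕ} (χ : Fin n → Side) (i : Fin n) : i ∈ chiList χ := by
  cases h : χ i <;> simp [chiList, h]

theorem nodup_chiList {n : ℕ} (χ : Fin n → Side) : (chiList χ).Nodup := by
  refine List.Nodup.append ((List.nodup_finRange n).filter _)
    (List.nodup_reverse.2 ((List.nodup_finRange n).filter _)) ?_
  intro i hi hj
  simp only [List.mem_filter, List.mem_reverse, decide_eq_true_eq] at hi hj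
  rw [hi.2] at hj
  exact absurd hj.2 (by decide)

theorem length_chiList {n : ℕ} (χ : Fin n → Side) : (chiList χ).length = n := by
  have h := Fintype.card_congr
    (List.Nodup.getEquivOfForallMemList (chiList χ) (nodup_chiList χ) (mem_chiList χ))
  simpa using h

/-- The permutation `s_χ`: its value at `k` is the `k`-th entry of `chiList χ`. -/
def chiPerm {n : ℕ} (χ : Fin n → Side) : Equiv.Perm (Fin n) :=
  (finCongr (length_chiList χ).symm).trans
    (List.Nodup.getEquivOfForallMemList (chiList χ) (nodup_chiList χ) (mem_chiList χ))

/-- The `χ`-order: `i ≺ j` iff `s_χ⁻¹ i < s_χ⁻¹ j`. -/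
def ChiLT {n : ℕ} (χ : Fin n → Side) (i j : Fin n) : Prop :=
  (chiPerm χ).symm i < (chiPerm χ).symm j

/-- A partition of `Fin n` is bi-non-crossing with respect to `χ` if blocks do not cross in the
`χ`-order. -/
def IsBNC {n : ℕ} (χ : Fin n → Side) (τ : Finpartition (Finset.univ : Finset (Fin n))) : Prop :=
  ∀ V ∈ τ.parts, ∀ W ∈ τ.parts, ∀ v₁ ∈ V, ∀ v₂ ∈ V, ∀ w₁ ∈ W, ∀ w₂ ∈ W,
    ChiLT χ v₁ w₁ → ChiLT χ w₁ v₂ → ChiLT χ v₂ w₂ → V = W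

/-- The set `BNC(χ)` of bi-non-crossing partitions, ordered by refinement: `τ ≤ σ` iff every block
of `τ` is contained in a block of `σ`. -/
abbrev BNC {n : ℕ} (χ : Fin n → Side) : Type :=
  {τ : Finpartition (Finset.univ : Finset (Fin n)) // IsBNC χ τ}

theorem isBNC_top {n : ℕ} (χ : Fin n → Side) : IsBNC χ ⊤ := by
  intro V hV W hW _ _ _ _ _ _ _ _ _ _ _
  have h := Finpartition.parts_top_subset (Finset.univ : Finset (Fin n))
  rw [Finset.mem_singleton.1 (h hV), Finset.mem_singleton.1 (h hW)]

/-- The one-block partition `1_χ` (which has no block if `n = 0`). -/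
def oneBNC {n : ℕ} (χ : Fin n → Side) : BNC χ := ⟨⊤, isBNC_top χ⟩

noncomputable instance instFintypeBNC {n : ℕ} (χ : Fin n → Side) : Fintype (BNC χ) :=
  Fintype.ofFinite _

noncomputable instance instLocallyFiniteOrderBNC {n : ℕ} (χ : Fin n → Side) :
    LocallyFiniteOrder (BNC χ) := by
  classical
  exact Fintype.toLocallyFiniteOrder

open Classical in
/-- The bi-non-crossing Möbius function: the Möbius function of the poset `BNC(χ)`. -/
noncomputable def muBNC {n : ℕ} (χ : Fin n → Side) (τ σ : BNC χ) : ℂ :=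
  IncidenceAlgebra.mu ℂ τ σ

section Cumulants

variable {A : Type*} [Ring A] [Algebra ℂ A]

/-- `φ` of the product of the `a i`, `i ∈ V`, taken in the natural increasing order of the
indices. -/
noncomputable def momentOn (φ : A →ₗ[ℂ] ℂ) {n : ℕ} (a : Fin n → A) (V : Finset (Fin n)) : ℂ :=
  φ ((V.sort (· ≤ ·)).map a).prod

/-- `φ_π (a₁, …, aₙ)`: the product over the blocks `V` of `π` of the moments of `a` on `V`. -/
noncomputable def momentPart (φ : A →ₗ[ℂ] ℂ) {n : ℕ} (a : Fin n → A)
    (π : Finpartition (Finset.univ : Finset (Fin n))) : ℂ :=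
  ∏ V ∈ π.parts, momentOn φ a V

open Classical in
/-- The bi-free cumulant `κ_{χ,τ} (a₁, …, aₙ)`, the sum over `σ ≤ τ` in `BNC(χ)` of
`φ_σ (a₁, …, aₙ) μ (σ, τ)`. -/
noncomputable def cumulantPart (φ : A →ₗ[ℂ] ℂ) {n : ℕ} (χ : Fin n → Side) (τ : BNC χ)
    (a : Fin n → A) : ℂ :=
  ∑ σ : BNC χ with σ ≤ τ, momentPart φ a σ.1 * muBNC χ σ τ

/-- The bi-free cumulant `κ_χ = κ_{χ, 1_χ}`. -/
noncomputable def cumulant (φ : A →ₗ[ℂ] ℂ) {n : ℕ} (χ : Fin n → Side) (a : Fin n → A) : ℂ :=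
  cumulantPart φ χ (oneBNC χ) a

end Cumulants

/-- The term at a position with side `s` and `*`-label `e`: one of `X`, `X*` (left), `Y`, `Y*`
(right); `e = true` marks a `*`-term. -/
def term {A : Type*} [Ring A] [StarRing A] (X Y : A) : Side → Bool → A
  | Side.l, false => X
  | Side.l, true => star X
  | Side.r, false => Y
  | Side.r, true => star Y

/-- The `*`-labels alternate when the indices are read in the `χ`-order, that is, along
`s_χ(1), …, s_χ(n)`. -/
def IsStarAlternating {n : ℕ} (χ : Fin n → Side) (ε : Fin n → Bool) : Prop :=
  ∀ j k : Fin n, (j : ℕ) + 1 = (k : ℕ) → ε (chiPerm χ j) ≠ ε (chiPerm χ k)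

/-- `(X, Y)` is bi-R-diagonal: the bi-free cumulants with entries `X, X*` at left positions and
`Y, Y*` at right positions vanish if they have odd order, and also if they have even order and are
not alternating in `*`-terms and non-`*`-terms in the `χ`-order. In that order all left positions
precede all right positions, so an alternating word of even length is of one of the forms
`(Z, Z*, …, Z, Z*)` with `Z` one of `X, X*, Y, Y*`; `(X, X*, …, X, X*, Y, Y*, …, Y, Y*)`;
`(X*, X, …, X*, X, Y*, Y, …, Y*, Y)`; `(X, X*, …, X, X*, X, Y*, Y, …, Y*, Y, Y*)`;
`(X*, X, …, X*, X, X*, Y, Y*, …, Y, Y*, Y)`. -/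
structure IsBiRDiagonal {A : Type*} [Ring A] [StarRing A] [Algebra ℂ A]
    (φ : A →ₗ[ℂ] ℂ) (X Y : A) : Prop where
  odd : ∀ (n : ℕ) (χ : Fin n → Side) (ε : Fin n → Bool), Odd n →
    cumulant φ χ (fun i => term X Y (χ i) (ε i)) = 0
  even : ∀ (n : ℕ) (χ : Fin n → Side) (ε : Fin n → Bool), Even n → ¬ IsStarAlternating χ ε →
    cumulant φ χ (fun i => term X Y (χ i) (ε i)) = 0

end BiFree

namespace BiFree

open Finset

/-! Write each `X ^ p` or `Y ^ p` as `p` equal factors, indexed by `Fin n ×ₗ Fin p`, with `q` the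
projection to `Fin n`. Möbius inversion (`sum_prod_mul_muBNC`) expresses a cumulant of the powers as
a sum, over non-crossing partitions `P` of the factors, of products of cumulants of `X, X*, Y, Y*`;
only those `P` count that lie over no `ρ ≠ 1_χ`, i.e. whose blocks together with the fibres of `q`
connect everything.

If the product for `P` is non-zero, bi-R-diagonality makes every block alternating of even length,
hence balanced: its signs (`+1` for a plain letter, `-1` for a starred one) sum to zero. Summing
over all blocks gives `p` times the sum of the `n` label signs, so `n` is even.

Suppose now that two `χ`-neighbours `i`, `j` carry equal labels. The block through the first factor
of `j` bounds an interval that is a union of blocks and contains or misses every fibre except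
perhaps one. Its signs sum to zero, so divisibility by `p` settles that fibre too. The interval is
then the preimage of a proper convex set `T` of indices (`exists_convex_union_of_blocks`), and `P`
lies over `{T, Tᶜ}`, which is bi-non-crossing and not `1_χ`. So `P` does not count. -/

/-- `P` is the set of blocks of a partition of `V` whose blocks do not cross with respect to
`r`. -/
structure IsNCPartition {α : Type*} (r : α → α → Prop) (V : Finset α) (P : Finset (Finset α)) :
    Prop where
  nonempty : ∀ B ∈ P, B.Nonempty
  eq_of_mem : ∀ B ∈ P, ∀ C ∈ P, ∀ x, x ∈ B → x ∈ C → B = C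
  mem_iff : ∀ x, x ∈ V ↔ ∃ B ∈ P, x ∈ B
  noncrossing : ∀ B ∈ P, ∀ C ∈ P, ∀ x ∈ B, ∀ x' ∈ B, ∀ y ∈ C, ∀ y' ∈ C,
    r x y → r y x' → r x' y' → B = C

/-! ### Non-crossing partitions of finite sets and the moment-cumulant relation. -/

section Generic

variable {α β : Type*} {r : α → α → Prop} {V : Finset α} {P : Finset (Finset α)}

theorem IsNCPartition.subset (h : IsNCPartition r V P) {B : Finset α} (hB : B ∈ P) : B ⊆ V :=
  fun x hx => (h.mem_iff x).2 ⟨B, hB, hx⟩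

theorem isNCPartition_singleton (r : α → α → Prop) (hV : V.Nonempty) :
    IsNCPartition r V {V} where
  nonempty := by simpa using hV
  eq_of_mem := by simp
  mem_iff := by simp
  noncrossing := by simp

open Classical in
/-- The partitions of `V` that are non-crossing with respect to `r`, as sets of blocks. -/
noncomputable def ncParts (r : α → α → Prop) (V : Finset α) : Finset (Finset (Finset α)) :=
  {P ∈ V.powerset.powerset | IsNCPartition r V P}

theorem mem_ncParts : P ∈ ncParts r V ↔ IsNCPartition r V P := by
  classical
  simp only [ncParts, mem_filter, mem_powerset, and_iff_right_iff_imp]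
  intro h B hB
  exact mem_powerset.2 (h.subset hB)

theorem IsNCPartition.eq_singleton (h : IsNCPartition r V P) {C : Finset α} (hC : C ∈ P)
    (hCV : C = V) : P = {V} := by
  obtain rfl := hCV
  refine eq_singleton_iff_unique_mem.2 ⟨hC, fun B hB => ?_⟩
  obtain ⟨x, hx⟩ := h.nonempty B hB
  exact h.eq_of_mem B hB C hC x hx (h.subset hB hx)

/-- The moment-cumulant relation between two set functions. -/
def MomentCumulant (r : α → α → Prop) (m κ : Finset α → ℂ) : Prop :=
  -- The only partition of `∅` has no blocks, so at `V = ∅` the relation would force `m ∅ = 1`.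
  ∀ V : Finset α, V.Nonempty → m V = ∑ P ∈ ncParts r V, ∏ B ∈ P, κ B

open Classical in
/-- The free cumulants of a set function of moments, defined by recursion on the moment-cumulant
relation. -/
noncomputable def ncCumulant (r : α → α → Prop) (m : Finset α → ℂ) (V : Finset α) : ℂ :=
  m V - ∑ P ∈ ((ncParts r V).erase {V}).attach, ∏ B ∈ P.1.attach, ncCumulant r m B.1
termination_by V.card
decreasing_by
  have hP := mem_erase.1 P.2
  have h := mem_ncParts.1 hP.2
  refine card_lt_card ((h.subset B.2).ssubset_of_ne fun he => hP.1 (h.eq_singleton B.2 he))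

theorem momentCumulant_ncCumulant (r : α → α → Prop) (m : Finset α → ℂ) :
    MomentCumulant r m (ncCumulant r m) := by
  classical
  intro V hV
  have h : {V} ∈ ncParts r V := mem_ncParts.2 (isNCPartition_singleton r hV)
  rw [← add_sum_erase _ _ h, prod_singleton]
  rw [ncCumulant.eq_1 r m V]
  have hattach : ∑ P ∈ ((ncParts r V).erase {V}).attach, ∏ B ∈ P.1.attach, ncCumulant r m B.1 =
      ∑ P ∈ (ncParts r V).erase {V}, ∏ B ∈ P, ncCumulant r m B := by
    rw [← sum_attach ((ncParts r V).erase {V})]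
    exact sum_congr rfl fun P _ => prod_attach P.1 (ncCumulant r m)
  rw [hattach]
  ring

/-- Refinement of sets of blocks. -/
def Refines (P R : Finset (Finset α)) : Prop := ∀ B ∈ P, ∃ W ∈ R, B ⊆ W

open Classical in
/-- Gluing non-crossing partitions of the blocks of a non-crossing partition `R`. -/
theorem prod_sum_ncParts {R : Finset (Finset α)} (hR : IsNCPartition r V R)
    (κ : Finset α → ℂ) :
    ∏ W ∈ R, ∑ Q ∈ ncParts r W, ∏ B ∈ Q, κ B =
      ∑ P ∈ ncParts r V with Refines P R, ∏ B ∈ P, κ B := by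
  rw [prod_sum]
  have key : ∀ f ∈ R.pi (fun W => ncParts r W), ∀ W (hW : W ∈ R), ∀ B ∈ f W hW,
      B ⊆ W ∧ B.Nonempty := fun f hf W hW B hB => by
    have h := mem_ncParts.1 (mem_pi.1 hf W hW)
    exact ⟨h.subset hB, h.nonempty B hB⟩
  have huniq : ∀ W ∈ R, ∀ W' ∈ R, ∀ B : Finset α, B.Nonempty → B ⊆ W → B ⊆ W' → W = W' :=
    fun W hW W' hW' B ⟨x, hx⟩ h h' => hR.eq_of_mem W hW W' hW' x (h hx) (h' hx)
  refine sum_bij' (fun f _ => R.attach.biUnion fun W => f W.1 W.2)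
    (fun P _ W _ => {B ∈ P | B ⊆ W}) ?_ ?_ ?_ ?_ ?_
  · intro f hf
    have hf' := fun W hW => mem_ncParts.1 (mem_pi.1 hf W hW)
    simp only [mem_filter, mem_ncParts]
    refine ⟨⟨?_, ?_, ?_, ?_⟩, ?_⟩
    · simp only [mem_biUnion, mem_attach, true_and, Subtype.exists]
      rintro B ⟨W, hW, hB⟩
      exact (key f hf W hW B hB).2
    · simp only [mem_biUnion, mem_attach, true_and, Subtype.exists]
      rintro B ⟨W, hW, hB⟩ C ⟨W', hW', hC⟩ x hxB hxC
      obtain rfl := hR.eq_of_mem W hW W' hW' x ((hf' W hW).subset hB hxB)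
        ((hf' W' hW').subset hC hxC)
      exact (hf' W hW).eq_of_mem B hB C hC x hxB hxC
    · intro x
      simp only [mem_biUnion, mem_attach, true_and, Subtype.exists, hR.mem_iff]
      constructor
      · rintro ⟨W, hW, hx⟩
        obtain ⟨B, hB, hxB⟩ := ((hf' W hW).mem_iff x).1 hx
        exact ⟨B, ⟨W, hW, hB⟩, hxB⟩
      · rintro ⟨B, ⟨W, hW, hB⟩, hxB⟩
        exact ⟨W, hW, (hf' W hW).subset hB hxB⟩
    · simp only [mem_biUnion, mem_attach, true_and, Subtype.exists]
      rintro B ⟨W, hW, hB⟩ C ⟨W', hW', hC⟩ x hx x' hx' y hy y' hy' h1 h2 h3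
      obtain rfl := hR.noncrossing W hW W' hW' x ((hf' W hW).subset hB hx)
        x' ((hf' W hW).subset hB hx') y ((hf' W' hW').subset hC hy)
        y' ((hf' W' hW').subset hC hy') h1 h2 h3
      exact (hf' W hW).noncrossing B hB C hC x hx x' hx' y hy y' hy' h1 h2 h3
    · intro B hB
      simp only [mem_biUnion, mem_attach, true_and, Subtype.exists] at hB
      obtain ⟨W, hW, hB⟩ := hB
      exact ⟨W, hW, (hf' W hW).subset hB⟩
  · intro P hP
    simp only [mem_filter, mem_ncParts] at hP
    obtain ⟨hP, hPR⟩ := hP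
    refine mem_pi.2 fun W hW => mem_ncParts.2 ⟨?_, ?_, ?_, ?_⟩
    · exact fun B hB => hP.nonempty B (mem_filter.1 hB).1
    · exact fun B hB C hC => hP.eq_of_mem B (mem_filter.1 hB).1 C (mem_filter.1 hC).1
    · intro x
      constructor
      · intro hx
        obtain ⟨B, hB, hxB⟩ := (hP.mem_iff x).1 (hR.subset hW hx)
        obtain ⟨W', hW', hBW'⟩ := hPR B hB
        obtain rfl := hR.eq_of_mem W hW W' hW' x hx (hBW' hxB)
        exact ⟨B, mem_filter.2 ⟨hB, hBW'⟩, hxB⟩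
      · rintro ⟨B, hB, hx⟩
        exact (mem_filter.1 hB).2 hx
    · exact fun B hB C hC => hP.noncrossing B (mem_filter.1 hB).1 C (mem_filter.1 hC).1
  · intro f hf
    funext W hW
    ext B
    simp only [mem_filter, mem_biUnion, mem_attach, true_and, Subtype.exists]
    constructor
    · rintro ⟨⟨W', hW', hB⟩, hBW⟩
      obtain rfl := huniq W hW W' hW' B (key f hf W' hW' B hB).2 hBW (key f hf W' hW' B hB).1
      exact hB
    · exact fun hB => ⟨⟨W, hW, hB⟩, (key f hf W hW B hB).1⟩
  · intro P hP
    simp only [mem_filter, mem_ncParts] at hP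
    ext B
    simp only [mem_filter, mem_biUnion, mem_attach, true_and, Subtype.exists, exists_prop]
    exact ⟨fun ⟨W, _, hB, _⟩ => hB, fun hB => (hP.2 B hB).imp fun W hW => ⟨hW.1, hB, hW.2⟩⟩
  · intro f hf
    rw [prod_biUnion]
    rintro ⟨W, hW⟩ - ⟨W', hW'⟩ - hne
    refine disjoint_left.2 fun B hB hB' => hne ?_
    obtain ⟨h1, h2⟩ := key f hf W hW B hB
    exact Subtype.ext (huniq W hW W' hW' B h2 h1 (key f hf W' hW' B hB').1)

theorem isNCPartition_map_iff {s : β → β → Prop} (e : α ↪ β)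
    (hrs : ∀ x y, r x y ↔ s (e x) (e y)) :
    IsNCPartition s (V.map e) (P.map (mapEmbedding e).toEmbedding) ↔ IsNCPartition r V P := by
  constructor
  · intro h
    have hm : ∀ B ∈ P, B.map e ∈ P.map (mapEmbedding e).toEmbedding :=
      fun B hB => mem_map.2 ⟨B, hB, rfl⟩
    refine ⟨?_, ?_, ?_, ?_⟩
    · exact fun B hB => map_nonempty.1 (h.nonempty _ (hm B hB))
    · exact fun B hB C hC x hx hx' => map_injective e (h.eq_of_mem _ (hm B hB) _ (hm C hC) (e x)
        (mem_map_of_mem e hx) (mem_map_of_mem e hx'))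
    · intro x
      have := h.mem_iff (e x)
      simpa using this
    · exact fun B hB C hC x hx x' hx' y hy y' hy' h1 h2 h3 =>
        map_injective e (h.noncrossing _ (hm B hB) _ (hm C hC) _ (mem_map_of_mem e hx) _
          (mem_map_of_mem e hx') _ (mem_map_of_mem e hy) _ (mem_map_of_mem e hy')
          ((hrs _ _).1 h1) ((hrs _ _).1 h2) ((hrs _ _).1 h3))
  · intro h
    refine ⟨?_, ?_, ?_, ?_⟩
    · simpa using h.nonempty
    · simp only [mem_map, RelEmbedding.coe_toEmbedding, mapEmbedding_apply]
      rintro _ ⟨B, hB, rfl⟩ _ ⟨C, hC, rfl⟩ _ hx hx'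
      obtain ⟨x, hxB, rfl⟩ := mem_map.1 hx
      rw [h.eq_of_mem B hB C hC x hxB ((mem_map' e).1 hx')]
    · intro x
      simp only [mem_map, RelEmbedding.coe_toEmbedding, mapEmbedding_apply, h.mem_iff]
      aesop
    · simp only [mem_map, RelEmbedding.coe_toEmbedding, mapEmbedding_apply]
      rintro _ ⟨B, hB, rfl⟩ _ ⟨C, hC, rfl⟩ _ hx _ hx' _ hy _ hy' h1 h2 h3
      obtain ⟨x, hxB, rfl⟩ := mem_map.1 hx
      obtain ⟨x', hxB', rfl⟩ := mem_map.1 hx'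
      obtain ⟨y, hyC, rfl⟩ := mem_map.1 hy
      obtain ⟨y', hyC', rfl⟩ := mem_map.1 hy'
      rw [h.noncrossing B hB C hC x hxB x' hxB' y hyC y' hyC' ((hrs _ _).2 h1) ((hrs _ _).2 h2)
        ((hrs _ _).2 h3)]

theorem ncParts_map {s : β → β → Prop} (e : α ↪ β) (hrs : ∀ x y, r x y ↔ s (e x) (e y)) :
    ncParts s (V.map e) =
      (ncParts r V).map (mapEmbedding (mapEmbedding e).toEmbedding).toEmbedding := by
  classical
  ext P
  simp only [mem_map, RelEmbedding.coe_toEmbedding, mapEmbedding_apply, mem_ncParts]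
  constructor
  · intro h
    have hP : ∃ Q : Finset (Finset α), P = Q.map (mapEmbedding e).toEmbedding := by
      have : P ⊆ V.powerset.map (mapEmbedding e).toEmbedding := fun B hB => by
        obtain ⟨C, hC, rfl⟩ := subset_map_iff.1 (h.subset hB)
        exact mem_map.2 ⟨C, mem_powerset.2 hC, rfl⟩
      obtain ⟨Q, -, hQ⟩ := subset_map_iff.1 this
      exact ⟨Q, hQ⟩
    obtain ⟨Q, rfl⟩ := hP
    exact ⟨Q, (isNCPartition_map_iff e hrs).1 h, rfl⟩
  · rintro ⟨Q, hQ, rfl⟩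
    exact (isNCPartition_map_iff e hrs).2 hQ

theorem MomentCumulant.comap {s : β → β → Prop} {m κ : Finset β → ℂ}
    (h : MomentCumulant s m κ) (e : α ↪ β) (hrs : ∀ x y, r x y ↔ s (e x) (e y)) :
    MomentCumulant r (fun V => m (V.map e)) (fun V => κ (V.map e)) := by
  intro V hV
  beta_reduce
  rw [h _ (map_nonempty.2 hV), ncParts_map e hrs, sum_map]
  simp

end Generic

/-! ### The `χ`-order on an arbitrary linear order. -/

section ChiOrder

variable {α β : Type*} [LinearOrder α] [LinearOrder β]

/-- The position of `x` in the `χ`-order: left elements in increasing order, followed by right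
elements in decreasing order. -/
def sideKey (χ : α → Side) (x : α) : α ⊕ₗ αᵒᵈ :=
  match χ x with
  | Side.l => toLex (Sum.inl x)
  | Side.r => toLex (Sum.inr (OrderDual.toDual x))

theorem sideKey_lt_iff (χ : α → Side) (x y : α) : sideKey χ x < sideKey χ y ↔
    (χ x = Side.l ∧ χ y = Side.l ∧ x < y) ∨ (χ x = Side.l ∧ χ y = Side.r) ∨
      (χ x = Side.r ∧ χ y = Side.r ∧ y < x) := by
  unfold sideKey
  cases χ x <;> cases χ y <;> simp

theorem sideKey_injective (χ : α → Side) : Function.Injective (sideKey χ) := by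
  intro x y h
  by_contra hne
  have h1 := sideKey_lt_iff χ x y
  have h2 := sideKey_lt_iff χ y x
  simp only [h, lt_irrefl, false_iff] at h1 h2
  rcases lt_or_gt_of_ne hne with h' | h' <;> cases hx : χ x <;> cases hy : χ y <;> simp_all

theorem sideKey_comp_lt_iff (χ : β → Side) (e : α ↪o β) (x y : α) :
    sideKey (χ ∘ e) x < sideKey (χ ∘ e) y ↔ sideKey χ (e x) < sideKey χ (e y) := by
  simp [sideKey_lt_iff]

/-- Since `q` may collapse points, the converse fails inside a fibre; the order between distinct
fibres is inherited, so each fibre is an interval. -/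
theorem sideKey_comp_lt (χ : β → Side) {q : α → β} (hq : Monotone q) {x y : α}
    (h : sideKey χ (q x) < sideKey χ (q y)) : sideKey (χ ∘ q) x < sideKey (χ ∘ q) y := by
  simp only [sideKey_lt_iff, Function.comp_apply] at h ⊢
  exact h.imp (fun h => ⟨h.1, h.2.1, hq.reflect_lt h.2.2⟩)
    (fun h => h.imp id fun h => ⟨h.1, h.2.1, hq.reflect_lt h.2.2⟩)

theorem pairwise_chiList {n : ℕ} (χ : Fin n → Side) :
    (chiList χ).Pairwise (fun i j => sideKey χ i < sideKey χ j) := by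
  simp only [sideKey_lt_iff, chiList, List.pairwise_append, List.pairwise_reverse]
  refine ⟨?_, ?_, ?_⟩
  · have h := (List.pairwise_lt_finRange n).filter (fun i => decide (χ i = Side.l))
    refine h.imp_of_mem fun {i j} hi hj hij => ?_
    simp only [List.mem_filter, decide_eq_true_eq] at hi hj
    exact Or.inl ⟨hi.2, hj.2, hij⟩
  · have h := (List.pairwise_lt_finRange n).filter (fun i => decide (χ i = Side.r))
    refine h.imp_of_mem fun {i j} hi hj hij => ?_
    simp only [List.mem_filter, decide_eq_true_eq] at hi hj
    exact Or.inr (Or.inr ⟨hj.2, hi.2, hij⟩)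
  · intro i hi j hj
    simp only [List.mem_filter, List.mem_reverse, decide_eq_true_eq] at hi hj
    exact Or.inr (Or.inl ⟨hi.2, hj.2⟩)

theorem strictMono_sideKey_chiPerm {n : ℕ} (χ : Fin n → Side) :
    StrictMono (fun k => sideKey χ (chiPerm χ k)) := by
  intro j k hjk
  exact List.pairwise_iff_get.1 (pairwise_chiList χ) _ _ (by simpa using hjk)

theorem chiLT_iff {n : ℕ} (χ : Fin n → Side) (i j : Fin n) :
    ChiLT χ i j ↔ sideKey χ i < sideKey χ j := by
  have h := (strictMono_sideKey_chiPerm χ).lt_iff_lt (a := (chiPerm χ).symm i)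
    (b := (chiPerm χ).symm j)
  simpa [ChiLT] using h.symm

end ChiOrder

/-! ### Möbius inversion and cumulants with products as entries. -/

section Moebius

variable {n : ℕ} {χ : Fin n → Side}

theorem le_oneBNC (ρ : BNC χ) : ρ ≤ oneBNC χ := le_top (a := ρ.1)

theorem univ_mem_parts_oneBNC (i : Fin n) : univ ∈ (oneBNC χ).1.parts := by
  obtain ⟨W, hW, -⟩ := (oneBNC χ).1.exists_mem (mem_univ i)
  rwa [mem_singleton.1 (Finpartition.parts_top_subset (univ : Finset (Fin n)) hW)] at hW

theorem isBNC_inf {τ σ : Finpartition (univ : Finset (Fin n))} (hτ : IsBNC χ τ)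
    (hσ : IsBNC χ σ) : IsBNC χ (τ ⊓ σ) := by
  intro V hV W hW v₁ hv₁ v₂ hv₂ w₁ hw₁ w₂ hw₂ h1 h2 h3
  simp only [Finpartition.parts_inf, mem_erase, mem_image, mem_product, Prod.exists] at hV hW
  obtain ⟨-, B, C, ⟨hB, hC⟩, rfl⟩ := hV
  obtain ⟨-, B', C', ⟨hB', hC'⟩, rfl⟩ := hW
  simp only [inf_eq_inter, mem_inter] at hv₁ hv₂ hw₁ hw₂
  rw [hτ B hB B' hB' v₁ hv₁.1 v₂ hv₂.1 w₁ hw₁.1 w₂ hw₂.1 h1 h2 h3,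
    hσ C hC C' hC' v₁ hv₁.2 v₂ hv₂.2 w₁ hw₁.2 w₂ hw₂.2 h1 h2 h3]

open Classical in
-- Closure under meets gives `U` a least element `ρ₀`, so `U` is the interval `[ρ₀, 1_χ]`, over
-- which the Möbius function sums to zero unless `ρ₀ = 1_χ`.
theorem sum_muBNC_of_inf_closed (U : Finset (BNC χ)) (hU : ∀ ρ ∈ U, ∀ σ, ρ ≤ σ → σ ∈ U)
    (hinf : ∀ ρ ∈ U, ∀ σ ∈ U, (⟨ρ.1 ⊓ σ.1, isBNC_inf ρ.2 σ.2⟩ : BNC χ) ∈ U)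
    (hone : oneBNC χ ∈ U) :
    ∑ ρ ∈ U, muBNC χ ρ (oneBNC χ) = if ∃ ρ ∈ U, ρ ≠ oneBNC χ then 0 else 1 := by
  obtain ⟨ρ₀, hρ₀⟩ := U.exists_minimal ⟨_, hone⟩
  have hle : ∀ ρ ∈ U, ρ₀ ≤ ρ := fun ρ hρ =>
    (hρ₀.2 (hinf ρ hρ ρ₀ hρ₀.1) (inf_le_right (a := ρ.1))).trans (inf_le_left (a := ρ.1))
  have hUI : U = Icc ρ₀ (oneBNC χ) := by
    ext ρ
    exact ⟨fun h => mem_Icc.2 ⟨hle ρ h, le_oneBNC ρ⟩, fun h => hU ρ₀ hρ₀.1 ρ (mem_Icc.1 h).1⟩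
  have hsum := IncidenceAlgebra.sum_Icc_mu_left (𝕜 := ℂ) ρ₀ (oneBNC χ)
  rw [← hUI] at hsum
  refine hsum.trans ?_
  by_cases h : ρ₀ = oneBNC χ
  · rw [if_pos h, if_neg]
    rintro ⟨ρ, hρ, hne⟩
    exact hne ((le_oneBNC ρ).antisymm (h ▸ hle ρ hρ))
  · rw [if_neg h, if_pos ⟨ρ₀, hρ₀.1, h⟩]

variable {α : Type*} [Fintype α] {q : α → Fin n} {r : α → α → Prop} {m κ : Finset α → ℂ}

/-- The preimage of a finset of indices. -/
def fiberOver (q : α → Fin n) (W : Finset (Fin n)) : Finset α := {x | q x ∈ W}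

@[simp]
theorem mem_fiberOver {W : Finset (Fin n)} {x : α} : x ∈ fiberOver q W ↔ q x ∈ W := by
  simp [fiberOver]

theorem fiberOver_injective (hq : Function.Surjective q) :
    Function.Injective (fiberOver q) := by
  intro V W h
  ext i
  obtain ⟨x, rfl⟩ := hq i
  rw [← mem_fiberOver, h, mem_fiberOver]

open Classical in
-- A crossing upstairs projects to a crossing of `ρ`, unless two consecutive points share an index;
-- then the two blocks of `ρ` meet and coincide.
theorem isNCPartition_image_fiberOver (hq : Function.Surjective q)
    (hr : ∀ x y, r x y → ChiLT χ (q x) (q y) ∨ q x = q y) (ρ : BNC χ) :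
    IsNCPartition r univ (ρ.1.parts.image (fiberOver q)) := by
  refine ⟨?_, ?_, ?_, ?_⟩
  · simp only [forall_mem_image]
    intro W hW
    obtain ⟨i, hi⟩ := ρ.1.nonempty_of_mem_parts hW
    obtain ⟨x, rfl⟩ := hq i
    exact ⟨x, mem_fiberOver.2 hi⟩
  · simp only [forall_mem_image, mem_fiberOver]
    intro V hV W hW x hx hx'
    rw [ρ.1.eq_of_mem_parts hV hW hx hx']
  · intro x
    obtain ⟨W, hW, hx⟩ := ρ.1.exists_mem (mem_univ (q x))
    simpa using ⟨W, hW, hx⟩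
  · simp only [forall_mem_image, mem_fiberOver]
    intro V hV W hW x hx x' hx' y hy y' hy' h1 h2 h3
    congr 1
    rcases hr _ _ h1 with h1 | h1
    · rcases hr _ _ h2 with h2 | h2
      · rcases hr _ _ h3 with h3 | h3
        · exact ρ.2 V hV W hW _ hx _ hx' _ hy _ hy' h1 h2 h3
        · exact ρ.1.eq_of_mem_parts hV hW hx' (h3 ▸ hy')
      · exact ρ.1.eq_of_mem_parts hV hW hx' (h2 ▸ hy)
    · exact ρ.1.eq_of_mem_parts hV hW hx (h1 ▸ hy)

/-- Every block of `P` lies over a block of `ρ`. -/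
def LiesOver (q : α → Fin n) (P : Finset (Finset α)) (ρ : BNC χ) : Prop :=
  ∀ B ∈ P, ∃ W ∈ ρ.1.parts, ∀ x ∈ B, q x ∈ W

open Classical in
-- Expanding the moments into cumulants and exchanging the sums leaves, for each `P`, the Möbius sum
-- over the `ρ` above `P`. These `ρ` are closed upwards and under meets, so that sum is `0` or `1`.
theorem sum_prod_mul_muBNC (hq : Function.Surjective q)
    (hr : ∀ x y, r x y → ChiLT χ (q x) (q y) ∨ q x = q y) (h : MomentCumulant r m κ) :
    ∑ ρ : BNC χ, (∏ W ∈ ρ.1.parts, m (fiberOver q W)) * muBNC χ ρ (oneBNC χ) =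
      ∑ P ∈ ncParts r univ, (∏ B ∈ P, κ B) *
        if ∃ ρ : BNC χ, LiesOver q P ρ ∧ ρ ≠ oneBNC χ then 0 else 1 := by
  have hglue : ∀ ρ : BNC χ, ∏ W ∈ ρ.1.parts, m (fiberOver q W) =
      ∑ P ∈ ncParts r univ, if LiesOver q P ρ then ∏ B ∈ P, κ B else 0 := by
    intro ρ
    have hR := isNCPartition_image_fiberOver hq hr ρ
    rw [← prod_image (f := m) (fiberOver_injective hq).injOn,
      prod_congr rfl fun W hW => h W (hR.nonempty W hW), prod_sum_ncParts hR, ← sum_filter]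
    refine sum_congr (filter_congr fun P _ => ?_) fun _ _ => rfl
    refine forall₂_congr fun B _ => ?_
    simp [subset_iff]
  simp_rw [hglue, sum_mul]
  rw [sum_comm]
  refine sum_congr rfl fun P hP => ?_
  simp_rw [ite_mul, zero_mul]
  rw [← sum_filter, ← mul_sum, sum_muBNC_of_inf_closed]
  · simp
  · simp only [mem_filter, mem_univ, true_and]
    intro ρ hρ σ hle B hB
    obtain ⟨W, hW, hBW⟩ := hρ B hB
    obtain ⟨W', hW', hWW'⟩ := hle hW
    exact ⟨W', hW', fun x hx => hWW' (hBW x hx)⟩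
  · simp only [mem_filter, mem_univ, true_and]
    intro ρ hρ σ hσ B hB
    obtain ⟨W, hW, hBW⟩ := hρ B hB
    obtain ⟨W', hW', hBW'⟩ := hσ B hB
    obtain ⟨x, hx⟩ := (mem_ncParts.1 hP).nonempty B hB
    refine ⟨W ∩ W', ?_, fun x hx => mem_inter.2 ⟨hBW x hx, hBW' x hx⟩⟩
    rw [Finpartition.parts_inf, mem_erase, mem_image]
    exact ⟨ne_empty_of_mem (mem_inter.2 ⟨hBW x hx, hBW' x hx⟩), (W, W'),
      mem_product.2 ⟨hW, hW'⟩, rfl⟩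
  · simp only [mem_filter, mem_univ, true_and]
    intro B hB
    obtain ⟨x, -⟩ := (mem_ncParts.1 hP).nonempty B hB
    exact ⟨univ, univ_mem_parts_oneBNC (q x), fun x _ => mem_univ _⟩

end Moebius

/-! ### Bi-free cumulants as solutions of the moment-cumulant relation. -/

section Cumulant

variable {A : Type*} [Ring A] [Algebra ℂ A]

theorem cumulant_eq_sum (φ : A →ₗ[ℂ] ℂ) {n : ℕ} (χ : Fin n → Side) (a : Fin n → A) :
    cumulant φ χ a = ∑ ρ : BNC χ, (∏ W ∈ ρ.1.parts, momentOn φ a W) * muBNC χ ρ (oneBNC χ) := by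
  classical
  unfold cumulant cumulantPart momentPart
  exact sum_congr (filter_true_of_mem fun ρ _ => le_oneBNC ρ) fun _ _ => rfl

/-- The non-crossing partition with the given set of blocks, as an element of `BNC χ`. -/
def IsNCPartition.toBNC {n : ℕ} {χ : Fin n → Side} {P : Finset (Finset (Fin n))}
    (h : IsNCPartition (ChiLT χ) univ P) : BNC χ :=
  ⟨Finpartition.ofExistsUnique P (fun _ _ => subset_univ _)
    (fun x hx => by
      obtain ⟨B, hB, hxB⟩ := (h.mem_iff x).1 hx
      exact ⟨B, ⟨hB, hxB⟩, fun C hC => h.eq_of_mem C hC.1 B hB x hC.2 hxB⟩)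
    (fun he => by simpa using h.nonempty _ he),
   fun V hV W hW v₁ hv₁ v₂ hv₂ w₁ hw₁ w₂ hw₂ =>
    h.noncrossing V hV W hW v₁ hv₁ v₂ hv₂ w₁ hw₁ w₂ hw₂⟩

theorem IsNCPartition.parts_toBNC {n : ℕ} {χ : Fin n → Side} {P : Finset (Finset (Fin n))}
    (h : IsNCPartition (ChiLT χ) univ P) : h.toBNC.1.parts = P := rfl

/-- For `q = id` every `P` is itself an element of `BNC χ` and lies over itself, so only the
one-block partition survives. -/
theorem cumulant_eq_of_momentCumulant (φ : A →ₗ[ℂ] ℂ) {n : ℕ} (hn : n ≠ 0) (χ : Fin n → Side)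
    (a : Fin n → A) {κ : Finset (Fin n) → ℂ}
    (h : MomentCumulant (ChiLT χ) (momentOn φ a) κ) : cumulant φ χ a = κ univ := by
  classical
  have : NeZero n := ⟨hn⟩
  have hs := sum_prod_mul_muBNC (χ := χ) (q := id) Function.surjective_id
    (fun _ _ h => Or.inl h) h
  have hid : ∀ W : Finset (Fin n), fiberOver id W = W := fun W => by ext; simp
  simp only [hid] at hs
  rw [cumulant_eq_sum, hs, sum_eq_single {univ}]
  · rw [if_neg, prod_singleton, mul_one]
    rintro ⟨ρ, hρ, hne⟩
    obtain ⟨W, hW, hle⟩ := hρ univ (mem_singleton_self _)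
    obtain rfl : W = univ := eq_univ_of_forall fun x => hle x (mem_univ x)
    exact hne ((le_oneBNC ρ).antisymm fun B _ => ⟨univ, hW, subset_univ B⟩)
  · intro P hP hne
    have hP := mem_ncParts.1 hP
    rw [if_pos, mul_zero]
    refine ⟨hP.toBNC, fun B hB => ⟨B, hB, fun x hx => hx⟩, fun he => hne ?_⟩
    refine hP.eq_singleton (C := univ) ?_ rfl
    have := univ_mem_parts_oneBNC (χ := χ) 0
    rwa [← he] at this
  · exact fun hne => (hne (mem_ncParts.2 (isNCPartition_singleton _ univ_nonempty))).elim

/-- The moments of a family indexed by a linear order. -/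
noncomputable def orderedMoment {α : Type*} [LinearOrder α] (φ : A →ₗ[ℂ] ℂ) (a : α → A)
    (V : Finset α) : ℂ :=
  φ (V.sort.map a).prod

theorem orderedMoment_map {α β : Type*} [LinearOrder α] [LinearOrder β] (φ : A →ₗ[ℂ] ℂ)
    (e : α ↪o β) (a : β → A) (V : Finset α) :
    orderedMoment φ a (V.map e.toEmbedding) = orderedMoment φ (a ∘ e) V := by
  unfold orderedMoment
  rw [← StrictMonoOn.map_finsetSort e.toEmbedding V (e.strictMono.strictMonoOn _),
    List.map_map]
  rfl

/-- The value of a cumulant set function at `V` is the bi-free cumulant of the subfamily indexed by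
`V`. -/
theorem MomentCumulant.eq_cumulant {α : Type*} [LinearOrder α] {φ : A →ₗ[ℂ] ℂ} {χ : α → Side}
    {a : α → A} {κ : Finset α → ℂ}
    (h : MomentCumulant (fun x y => sideKey χ x < sideKey χ y) (orderedMoment φ a) κ)
    {V : Finset α} (hV : V.Nonempty) :
    κ V = cumulant φ (χ ∘ V.orderEmbOfFin rfl) (a ∘ V.orderEmbOfFin rfl) := by
  set e := V.orderEmbOfFin rfl
  have h' := h.comap (r := ChiLT (χ ∘ e)) e.toEmbedding fun x y => by
    rw [chiLT_iff]
    exact sideKey_comp_lt_iff χ e x y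
  simp_rw [orderedMoment_map] at h'
  rw [cumulant_eq_of_momentCumulant φ hV.card_ne_zero _ _ h']
  congr 1
  exact (V.map_orderEmbOfFin_univ rfl).symm

end Cumulant

/-! ### Counting signs in fibres and in unions of blocks. -/

/-- The sign of a `*`-label. -/
def labelSign (b : Bool) : ℤ := if b then -1 else 1

theorem labelSign_eq_neg {b c : Bool} (h : b ≠ c) : labelSign c = -labelSign b := by
  cases b <;> cases c <;> simp_all [labelSign]

theorem isUnit_labelSign (b : Bool) : IsUnit (labelSign b) := by
  cases b <;> simp [labelSign]

theorem even_card_of_sum_labelSign_eq_zero {ι : Type*} (s : Finset ι) (ε : ι → Bool)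
    (h : ∑ i ∈ s, labelSign (ε i) = 0) : Even s.card := by
  have h2 : ∀ i ∈ s, labelSign (ε i) = 1 - 2 * (if ε i then 1 else 0) := fun i _ => by
    cases ε i <;> simp [labelSign]
  rw [sum_congr rfl h2, sum_sub_distrib, ← mul_sum, sum_const, nsmul_eq_mul, mul_one] at h
  rw [← Int.even_coe_nat]
  exact ⟨∑ i ∈ s, if ε i then 1 else 0, by linarith⟩

theorem sum_eq_zero_of_alternating (M : ℕ) (f : Fin (2 * M) → ℤ)
    (h : ∀ j k : Fin (2 * M), (j : ℕ) + 1 = k → f k = -f j) : ∑ k, f k = 0 := by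
  induction M with
  | zero => simp
  | succ M ih =>
    have h' := ih (fun k => f k.succ.succ) fun j k hjk => h _ _ (by simp [← hjk])
    have h01 : f (0 : Fin (2 * M + 1)).succ = -f 0 :=
      h _ _ (by simpa using (Nat.mod_eq_of_lt (by omega)).symm)
    refine (Fin.sum_univ_succ (n := 2 * M + 1) f).trans ?_
    rw [Fin.sum_univ_succ, h', h01]
    ring

section Saturation

variable {α ι : Type*} [Fintype α] [DecidableEq ι] {q : α → ι} {p : ℕ}

/-- A set that is saturated with respect to `q` up to one fibre, and whose sum of signs is zero,
is saturated. -/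
theorem saturated_of_sum_labelSign_eq_zero (hfib : ∀ i, #{x | q x = i} = p) (ε : ι → Bool)
    {T : Finset α} (hT : ∑ x ∈ T, labelSign (ε (q x)) = 0) {c : ι}
    (hsat : ∀ x y, q x = q y → q x ≠ c → x ∈ T → y ∈ T) :
    ∀ x y, q x = q y → x ∈ T → y ∈ T := by
  have hfull : ∀ i, ∑ x ∈ T with q x = i, labelSign (ε (q x)) =
      #{x ∈ T | q x = i} * labelSign (ε i) := fun i => by
    rw [sum_congr rfl (g := fun _ => labelSign (ε i))
      (fun x hx => by rw [(mem_filter.1 hx).2]), sum_const, nsmul_eq_mul]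
  have hcard : ∀ i ∈ T.image q, i ≠ c → #{x ∈ T | q x = i} = p := by
    intro i hi hic
    obtain ⟨x, hx, rfl⟩ := mem_image.1 hi
    rw [← hfib (q x)]
    congr 1
    ext y
    simp only [mem_filter, mem_univ, true_and, and_iff_right_iff_imp]
    exact fun hy => hsat x y hy.symm hic hx
  intro x y hxy hx
  by_cases hxc : q x ≠ c
  · exact hsat x y hxy hxc hx
  push Not at hxc
  rw [← sum_fiberwise_of_maps_to (fun x hx => mem_image_of_mem q hx),
    ← add_sum_erase _ _ (hxc ▸ mem_image_of_mem q hx), hfull] at hT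
  -- Every other fibre meeting `T` is full and contributes `± p`. Hence `p` divides the number of
  -- points of `T` over `c`, which is at most `p`; if positive it equals `p`.
  have hdvd : (p : ℤ) ∣ ∑ i ∈ (T.image q).erase c, ∑ x ∈ T with q x = i, labelSign (ε (q x)) := by
    refine dvd_sum fun i hi => ?_
    rw [hfull, hcard i (mem_erase.1 hi).2 (mem_erase.1 hi).1]
    exact dvd_mul_right _ _
  have hdvd' : (p : ℤ) ∣ #{x ∈ T | q x = c} * labelSign (ε c) :=
    (dvd_add_left hdvd).1 (hT ▸ dvd_zero _)
  rw [(isUnit_labelSign _).dvd_mul_right, Int.natCast_dvd_natCast] at hdvd'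
  have hpos : 0 < #{x ∈ T | q x = c} := card_pos.2 ⟨x, mem_filter.2 ⟨hx, hxc⟩⟩
  have hsub : ({x ∈ T | q x = c} : Finset α) ⊆ ({x | q x = c} : Finset α) := fun x hx => by
    simpa using (mem_filter.1 hx).2
  have heq := eq_of_subset_of_card_le hsub (by rw [hfib]; exact Nat.le_of_dvd hpos hdvd')
  have hy : y ∈ ({x ∈ T | q x = c} : Finset α) := by
    rw [heq]
    simpa using hxy ▸ hxc
  exact (mem_filter.1 hy).1

theorem even_card_of_balanced [Fintype ι] (hp : p ≠ 0) (hfib : ∀ i, #{x | q x = i} = p)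
    (ε : ι → Bool) (h : ∑ x, labelSign (ε (q x)) = 0) : Even (Fintype.card ι) := by
  refine even_card_of_sum_labelSign_eq_zero univ ε ?_
  have hfull : ∀ i, ∑ x with q x = i, labelSign (ε (q x)) = p * labelSign (ε i) := fun i => by
    rw [sum_congr rfl (g := fun _ => labelSign (ε i))
      (fun x hx => by rw [(mem_filter.1 hx).2]), sum_const, nsmul_eq_mul, hfib]
  rw [← sum_fiberwise_of_maps_to (fun x _ => mem_univ (q x)), sum_congr rfl fun i _ => hfull i,
    ← mul_sum] at h
  exact (mul_eq_zero.1 h).resolve_left (by exact_mod_cast hp)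

end Saturation

theorem IsNCPartition.sum_eq_zero {α : Type*} {r : α → α → Prop} {V : Finset α}
    {P : Finset (Finset α)} (hP : IsNCPartition r V P) (f : α → ℤ)
    (hf : ∀ B ∈ P, ∑ x ∈ B, f x = 0) {T : Finset α} (hTV : T ⊆ V)
    (hT : ∀ B ∈ P, ∀ x ∈ B, ∀ y ∈ B, x ∈ T → y ∈ T) : ∑ x ∈ T, f x = 0 := by
  classical
  have hTP : T = {B ∈ P | B ⊆ T}.biUnion id := by
    ext x
    simp only [mem_biUnion, mem_filter, id]
    constructor
    · intro hx
      obtain ⟨B, hB, hxB⟩ := (hP.mem_iff x).1 (hTV hx)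
      exact ⟨B, ⟨hB, fun y hy => hT B hB x hxB y hy hx⟩, hxB⟩
    · rintro ⟨B, ⟨-, hB⟩, hx⟩
      exact hB hx
  rw [hTP, sum_biUnion]
  · exact Finset.sum_eq_zero fun B hB => hf B (mem_filter.1 hB).1
  · intro B hB C hC hne
    exact disjoint_left.2 fun x hx hx' => hne
      (hP.eq_of_mem B (mem_filter.1 hB).1 C (mem_filter.1 hC).1 x hx hx')

/-! ### The convex set produced by two equal neighbouring labels. -/

section Convex

variable {α ι γ δ : Type*} [Fintype α] [LinearOrder γ] [LinearOrder δ]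
  {k : α → γ} {l : ι → δ} {q : α → ι} {p : ℕ} {P : Finset (Finset α)}

/-- If two neighbouring fibres carry the same label and all blocks of a non-crossing partition are
balanced and alternating, then some non-trivial convex set of indices has a preimage that is a
union of blocks. -/
theorem exists_convex_union_of_blocks (hk : Function.Injective k) (hl : Function.Injective l)
    (hkl : ∀ x y, l (q x) < l (q y) → k x < k y) (hp : p ≠ 0)
    [DecidableEq ι] (hfib : ∀ i, #{x | q x = i} = p) (ε : ι → Bool)
    (hP : IsNCPartition (fun x y => k x < k y) univ P)
    (hbal : ∀ B ∈ P, ∑ x ∈ B, labelSign (ε (q x)) = 0)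
    (halt : ∀ B ∈ P, ∀ x ∈ B, ∀ y ∈ B, k x < k y → (∀ z ∈ B, k x < k z → ¬ k z < k y) →
      ε (q x) ≠ ε (q y))
    {i j : ι} (hij : l i < l j) (hcov : ∀ c, l i < l c → ¬ l c < l j) (hε : ε i = ε j) :
    ∃ T : Finset ι, (∃ a, a ∈ T) ∧ (∃ b, b ∉ T) ∧
      (∀ a ∈ T, ∀ c ∈ T, ∀ b, l a < l b → l b < l c → b ∈ T) ∧
      ∀ B ∈ P, ∀ x ∈ B, ∀ y ∈ B, q x ∈ T → q y ∈ T := by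
  have hle : ∀ {x y}, k x ≤ k y → l (q x) ≤ l (q y) := fun {x y} h =>
    not_lt.1 fun h' => (hkl y x h').not_ge h
  have hne : ∀ i, ∃ x, q x = i := fun i => by
    obtain ⟨x, hx⟩ := card_pos.1 ((Nat.pos_of_ne_zero hp).trans_eq (hfib i).symm)
    exact ⟨x, (mem_filter.1 hx).2⟩
  obtain ⟨z, hz⟩ := hne i
  obtain ⟨w, hw, hwmin⟩ : ∃ w, q w = j ∧ ∀ x, q x = j → k w ≤ k x := by
    obtain ⟨x, hx⟩ := hne j
    obtain ⟨w, hw, hmin⟩ := exists_min_image ({x | q x = j} : Finset α) k ⟨x, by simpa using hx⟩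
    exact ⟨w, (mem_filter.1 hw).2, fun x hx => hmin x (by simpa using hx)⟩
  have hzw : k z < k w := hkl _ _ (by rwa [hz, hw])
  obtain ⟨W, hW, hwW⟩ := (hP.mem_iff w).1 (mem_univ w)
  -- It is enough to find an interval of points that is a union of blocks and saturated off one
  -- fibre `c`: balance gives saturation at `c`, and `T` descends to indices.
  suffices h : ∃ (T : Finset α) (c : ι), (∃ x, x ∈ T) ∧ (∃ y, y ∉ T) ∧
      (∀ x ∈ T, ∀ x' ∈ T, ∀ y, k x < k y → k y < k x' → y ∈ T) ∧
      (∀ B ∈ P, ∀ x ∈ B, ∀ y ∈ B, x ∈ T → y ∈ T) ∧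
      (∀ x y, q x = q y → q x ≠ c → x ∈ T → y ∈ T) by
    obtain ⟨T, c, ⟨x, hx⟩, ⟨y, hy⟩, hconv, hclosed, hsat⟩ := h
    have hsat' := saturated_of_sum_labelSign_eq_zero hfib ε
      (hP.sum_eq_zero _ hbal (subset_univ T) hclosed) hsat
    have hmem : ∀ {x}, q x ∈ T.image q ↔ x ∈ T := fun {x} => by
      refine ⟨fun h => ?_, mem_image_of_mem q⟩
      obtain ⟨x', hx', he⟩ := mem_image.1 h
      exact hsat' x' x he hx'
    refine ⟨T.image q, ⟨q x, hmem.2 hx⟩, ⟨q y, fun h => hy (hmem.1 h)⟩, ?_, ?_⟩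
    · intro a ha c hc b hab hbc
      obtain ⟨x, rfl⟩ := hne a
      obtain ⟨x', rfl⟩ := hne c
      obtain ⟨y, rfl⟩ := hne b
      exact hmem.2 (hconv x (hmem.1 ha) x' (hmem.1 hc) y (hkl _ _ hab) (hkl _ _ hbc))
    · intro B hB x hx y hy h
      exact hmem.2 (hclosed B hB x hx y hy (hmem.1 h))
  -- A block other than `W` that enters the gap between two points of `W` stays there, since leaving
  -- would cross `W`.
  have hgap : ∀ w₁ ∈ W, ∀ w₂ ∈ W, ∀ B ∈ P, B ≠ W → ∀ x ∈ B, ∀ y ∈ B,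
      k w₁ < k x → k x < k w₂ → k w₁ < k y ∧ k y < k w₂ := by
    intro w₁ hw₁ w₂ hw₂ B hB hBW x hx y hy h1 h2
    have hyW : ∀ w' ∈ W, k w' ≠ k y := fun w' hw' he => hBW
      (hP.eq_of_mem B hB W hW w' (hk he ▸ hy) hw')
    constructor
    · refine lt_of_not_ge fun h => hBW ?_
      exact hP.noncrossing B hB W hW y hy x hx w₁ hw₁ w₂ hw₂
        (lt_of_le_of_ne h (hyW w₁ hw₁).symm) h1 h2
    · refine lt_of_not_ge fun h => hBW ?_
      exact (hP.noncrossing W hW B hB w₁ hw₁ w₂ hw₂ x hx y hy h1 h2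
        (lt_of_le_of_ne h (hyW w₂ hw₂))).symm
  -- If `w` has a predecessor `w'` in `W`, the open interval between them works: it contains `z` but
  -- not `w`. Otherwise `W` starts at `w`, and the closed interval it spans works: it contains `w`
  -- but not `z`.
  by_cases hpred : ∃ w' ∈ W, k w' < k w
  · obtain ⟨w', hw', hmax⟩ := exists_max_image {x ∈ W | k x < k w} k
      (by obtain ⟨w', h1, h2⟩ := hpred; exact ⟨w', mem_filter.2 ⟨h1, h2⟩⟩)
    obtain ⟨hw'W, hw'w⟩ := mem_filter.1 hw'
    have hgapW : ∀ x ∈ W, k w' < k x → ¬ k x < k w := fun x hx h1 h2 =>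
      (hmax x (mem_filter.2 ⟨hx, h2⟩)).not_gt h1
    have hεne := halt W hW w' hw'W w hwW hw'w hgapW
    -- Alternation gives `w'` a label different from the common label of `i` and `j`, so `w'` lies
    -- over neither and hence strictly before `i`.
    have hc : l (q w') < l i := by
      have h1 : l (q w') < l j := lt_of_le_of_ne (hw ▸ hle hw'w.le)
        fun h => hεne (by rw [hl h, hw])
      refine lt_of_le_of_ne (not_lt.1 fun h => hcov _ h h1) fun h => hεne ?_
      rw [hl h, hw, hε]
    refine ⟨({x | k w' < k x ∧ k x < k w} : Finset α), q w', ⟨z, ?_⟩, ⟨w, by simp⟩, ?_, ?_, ?_⟩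
    · simpa using ⟨hkl _ _ (hz ▸ hc), hzw⟩
    · simp only [mem_filter, mem_univ, true_and]
      exact fun x hx x' hx' y h1 h2 => ⟨hx.1.trans h1, h2.trans hx'.2⟩
    · simp only [mem_filter, mem_univ, true_and]
      intro B hB x hx y hy h
      by_cases hBW : B = W
      · exact (hgapW x (hBW ▸ hx) h.1 h.2).elim
      · exact hgap w' hw'W w hwW B hB hBW x hx y hy h.1 h.2
    · simp only [mem_filter, mem_univ, true_and]
      intro x y hxy hxc h
      refine ⟨hkl _ _ ?_, hkl _ _ ?_⟩
      · exact hxy ▸ lt_of_le_of_ne (hle h.1.le) fun he => hxc (hl he).symm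
      · exact hxy ▸ lt_of_le_of_ne (hle h.2.le) fun he =>
          (hwmin x ((hl he).trans hw)).not_gt h.2
  · push Not at hpred
    obtain ⟨w', hw'W, hmax⟩ := exists_max_image W k ⟨w, hwW⟩
    refine ⟨({x | k w ≤ k x ∧ k x ≤ k w'} : Finset α), q w', ⟨w, ?_⟩, ⟨z, ?_⟩, ?_, ?_, ?_⟩
    · simpa using hmax w hwW
    · simpa using fun h : k w ≤ k z => (hzw.not_ge h).elim
    · simp only [mem_filter, mem_univ, true_and]
      exact fun x hx x' hx' y h1 h2 => ⟨hx.1.trans h1.le, h2.le.trans hx'.2⟩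
    · simp only [mem_filter, mem_univ, true_and]
      intro B hB x hx y hy h
      by_cases hBW : B = W
      · exact ⟨hpred y (hBW ▸ hy), hmax y (hBW ▸ hy)⟩
      · have hxW : ∀ v ∈ W, k v ≠ k x := fun v hv he => hBW
          (hP.eq_of_mem B hB W hW v (hk he ▸ hx) hv)
        have := hgap w hwW w' hw'W B hB hBW x hx y hy (lt_of_le_of_ne h.1 (hxW w hwW))
          (lt_of_le_of_ne h.2 (hxW w' hw'W).symm)
        exact ⟨this.1.le, this.2.le⟩
    · simp only [mem_filter, mem_univ, true_and]
      intro x y hxy hxc h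
      -- Minimality of `w` in its fibre makes the left end a fibre boundary; only the fibre of the
      -- right end `w'` can be cut.
      constructor
      · by_cases hy : q y = j
        · exact hwmin y hy
        · refine (hkl _ _ ?_).le
          exact hxy ▸ lt_of_le_of_ne (hle h.1) fun he => hy (hxy ▸ (hl he).symm.trans hw)
      · refine (hkl _ _ ?_).le
        exact hxy ▸ lt_of_le_of_ne (hle h.2) fun he => hxc (hl he)

end Convex

/-! ### Bi-R-diagonality of powers. -/

section Powers

variable {A : Type*} [Ring A]

/-- Monotonicity of `q` keeps the factors of each power adjacent in the natural order, so moments of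
powers are moments of the unfolded family over preimages. -/
theorem prod_sort_fiberOver {α : Type*} [LinearOrder α] [Fintype α] {n p : ℕ} {q : α → Fin n}
    (hq : Monotone q) (hfib : ∀ i, #{x | q x = i} = p) (a : Fin n → A) (W : Finset (Fin n)) :
    ((fiberOver q W).sort.map (a ∘ q)).prod = (W.sort.map fun i => a i ^ p).prod := by
  induction W using Finset.induction_on_min with
  | empty =>
    have : fiberOver q ∅ = ∅ := by ext; simp
    simp [this]
  | insert i s hi ih =>
    have his : i ∉ s := fun h => (hi i h).false
    have hsplit : (fiberOver q (insert i s)).sort =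
        ({x | q x = i} : Finset α).sort ++ (fiberOver q s).sort := by
      refine List.Perm.eq_of_pairwise' (r := (· ≤ ·)) (pairwise_sort _ _) ?_ ?_
      · refine List.pairwise_append.2 ⟨pairwise_sort _ _, pairwise_sort _ _, fun x hx y hy => ?_⟩
        simp only [mem_sort, mem_filter, mem_univ, true_and, mem_fiberOver] at hx hy
        exact (hq.reflect_lt (hx ▸ hi _ hy)).le
      · refine (List.perm_ext_iff_of_nodup (sort_nodup _ _) ?_).2 fun x => by simp
        refine List.Nodup.append (sort_nodup _ _) (sort_nodup _ _) fun x hx hy => ?_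
        simp only [mem_sort, mem_filter, mem_univ, true_and, mem_fiberOver] at hx hy
        exact his (hx ▸ hy)
    have hrep : (({x | q x = i} : Finset α).sort.map (a ∘ q)) = List.replicate p (a i) := by
      refine List.eq_replicate_iff.2 ⟨by simp [hfib], fun b hb => ?_⟩
      obtain ⟨x, hx, rfl⟩ := List.mem_map.1 hb
      simp only [mem_sort, mem_filter, mem_univ, true_and] at hx
      simp [hx]
    rw [hsplit, List.map_append, List.prod_append, hrep, ih, List.prod_replicate,
      sort_insert _ (fun j hj => (hi j hj).le) his, List.map_cons, List.prod_cons]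

theorem term_pow [StarRing A] (X Y : A) (p : ℕ) (s : Side) (b : Bool) :
    term (X ^ p) (Y ^ p) s b = term X Y s b ^ p := by
  cases s <;> cases b <;> simp [term]

variable [StarRing A] [Algebra ℂ A] {φ : A →ₗ[ℂ] ℂ} {X Y : A}

theorem IsBiRDiagonal.even_and_isStarAlternating (h : IsBiRDiagonal φ X Y) {n : ℕ}
    {χ : Fin n → Side} {ε : Fin n → Bool}
    (hne : cumulant φ χ (fun i => term X Y (χ i) (ε i)) ≠ 0) :
    Even n ∧ IsStarAlternating χ ε := by
  have hn : Even n := Nat.not_odd_iff_even.1 fun hn => hne (h.odd n χ ε hn)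
  exact ⟨hn, by_contra fun h' => hne (h.even n χ ε hn h')⟩

theorem IsStarAlternating.sum_labelSign {n : ℕ} {χ : Fin n → Side} {ε : Fin n → Bool}
    (h : IsStarAlternating χ ε) (hn : Even n) : ∑ i, labelSign (ε i) = 0 := by
  obtain ⟨M, rfl⟩ := hn.exists_two_nsmul n
  rw [← Equiv.sum_comp (chiPerm χ)]
  exact sum_eq_zero_of_alternating M _ fun j k hjk => labelSign_eq_neg (h j k hjk)

theorem IsStarAlternating.ne_of_consecutive {n : ℕ} {χ : Fin n → Side} {ε : Fin n → Bool}
    (h : IsStarAlternating χ ε) {x y : Fin n} (hxy : ChiLT χ x y)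
    (hcons : ∀ z, ChiLT χ x z → ¬ ChiLT χ z y) : ε x ≠ ε y := by
  unfold ChiLT at hxy hcons
  have hsucc : (((chiPerm χ).symm x : Fin n) : ℕ) + 1 = (chiPerm χ).symm y := by
    by_contra hne
    have hlt : (((chiPerm χ).symm x : Fin n) : ℕ) + 1 < (chiPerm χ).symm y :=
      lt_of_le_of_ne hxy hne
    refine hcons (chiPerm χ ⟨_, hlt.trans (Fin.is_lt _)⟩) ?_ ?_
    · rw [Equiv.symm_apply_apply]
      exact Nat.lt_succ_self _
    · rw [Equiv.symm_apply_apply]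
      exact hlt
  simpa using h _ _ hsucc

section Blocks

variable {α : Type*} [LinearOrder α] {χ : α → Side} {ε : α → Bool} {κ : Finset α → ℂ}

theorem IsBiRDiagonal.balanced_and_alternating (h : IsBiRDiagonal φ X Y)
    (hκ : MomentCumulant (fun x y => sideKey χ x < sideKey χ y)
      (orderedMoment φ fun x => term X Y (χ x) (ε x)) κ)
    {V : Finset α} (hV : V.Nonempty) (hne : κ V ≠ 0) :
    ∑ x ∈ V, labelSign (ε x) = 0 ∧
      ∀ x ∈ V, ∀ y ∈ V, sideKey χ x < sideKey χ y →
        (∀ z ∈ V, sideKey χ x < sideKey χ z → ¬ sideKey χ z < sideKey χ y) → ε x ≠ ε y := by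
  rw [hκ.eq_cumulant hV] at hne
  obtain ⟨heven, halt⟩ := h.even_and_isStarAlternating (ε := ε ∘ V.orderEmbOfFin rfl) hne
  constructor
  · rw [← V.map_orderEmbOfFin_univ rfl, sum_map]
    exact halt.sum_labelSign heven
  · have hmem : ∀ x ∈ V, ∃ i, V.orderEmbOfFin rfl i = x := fun x hx => by
      have : x ∈ Set.range (V.orderEmbOfFin rfl) := by rwa [range_orderEmbOfFin]
      exact this
    intro x hx y hy hxy hcons
    obtain ⟨i, rfl⟩ := hmem x hx
    obtain ⟨j, rfl⟩ := hmem y hy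
    refine halt.ne_of_consecutive (x := i) (y := j) ?_ fun z hz hz' => ?_
    · rwa [chiLT_iff, sideKey_comp_lt_iff]
    · rw [chiLT_iff, sideKey_comp_lt_iff] at hz hz'
      exact hcons _ (V.orderEmbOfFin_mem rfl z) hz hz'

end Blocks

/-- In any crossing of `T` with `Tᶜ`, a point of `Tᶜ` lies between two points of `T`. -/
theorem isNCPartition_pair_compl {n : ℕ} {χ : Fin n → Side} {T : Finset (Fin n)}
    (hT : T.Nonempty) (hT' : Tᶜ.Nonempty)
    (hconv : ∀ a ∈ T, ∀ c ∈ T, ∀ b,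
      sideKey χ a < sideKey χ b → sideKey χ b < sideKey χ c → b ∈ T) :
    IsNCPartition (ChiLT χ) univ {T, Tᶜ} := by
  refine ⟨?_, ?_, ?_, ?_⟩
  · simp [hT, hT']
  · simp only [mem_insert, mem_singleton]
    rintro B (rfl | rfl) C (rfl | rfl) x hx hx' <;> simp_all
  · intro x
    by_cases hx : x ∈ T <;> simp [hx]
  · simp only [chiLT_iff, mem_insert, mem_singleton]
    rintro B (rfl | rfl) C (rfl | rfl) x hx x' hx' y hy y' hy' h1 h2 h3
    · rfl
    · exact (mem_compl.1 hy (hconv x hx x' hx' y h1 h2)).elim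
    · exact (mem_compl.1 hx' (hconv y hy y' hy' x' h2 h3)).elim
    · rfl

/-- The form of `hn` treats both parities at once: a non-zero product of block cumulants forces `n`
to be even, and only then is a failure of alternation needed. -/
theorem IsBiRDiagonal.pow_cumulant_eq_zero (h : IsBiRDiagonal φ X Y) {p : ℕ} (hp : p ≠ 0)
    {n : ℕ} (χ : Fin n → Side) (ε : Fin n → Bool) (hn : Even n → ¬ IsStarAlternating χ ε) :
    cumulant φ χ (fun i => term (X ^ p) (Y ^ p) (χ i) (ε i)) = 0 := by
  classical
  let q : Fin n ×ₗ Fin p → Fin n := fun x => (ofLex x).1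
  have hq : Monotone q := Prod.Lex.monotone_fst_ofLex
  have hsurj : Function.Surjective q := fun i => ⟨toLex (i, ⟨0, Nat.pos_of_ne_zero hp⟩), rfl⟩
  have hfib : ∀ i, #{x | q x = i} = p := fun i => by
    have : ({x | q x = i} : Finset (Fin n ×ₗ Fin p)) =
        (univ : Finset (Fin p)).image (fun j => toLex (i, j)) := by
      ext x
      simp only [mem_filter, mem_univ, true_and, mem_image]
      exact ⟨fun hx => ⟨(ofLex x).2, by rw [← hx]; rfl⟩, fun ⟨j, hj⟩ => hj ▸ rfl⟩
    rw [this, card_image_of_injective _ fun j j' hj => (Prod.ext_iff.1 (toLex.injective hj)).2,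
      card_univ, Fintype.card_fin]
  let a : Fin n → A := fun i => term X Y (χ i) (ε i)
  have hκ := momentCumulant_ncCumulant (fun x y => sideKey (χ ∘ q) x < sideKey (χ ∘ q) y)
    (orderedMoment φ (a ∘ q))
  set κ := ncCumulant (fun x y => sideKey (χ ∘ q) x < sideKey (χ ∘ q) y) (orderedMoment φ (a ∘ q))
  have hkl : ∀ x y, sideKey χ (q x) < sideKey χ (q y) →
      sideKey (χ ∘ q) x < sideKey (χ ∘ q) y := fun x y => sideKey_comp_lt χ hq
  have hmom : ∀ W, momentOn φ (fun i => term (X ^ p) (Y ^ p) (χ i) (ε i)) W =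
      orderedMoment φ (a ∘ q) (fiberOver q W) := fun W => by
    simp_rw [momentOn, orderedMoment, prod_sort_fiberOver hq hfib, term_pow]
    rfl
  rw [cumulant_eq_sum]
  simp_rw [hmom]
  rw [sum_prod_mul_muBNC hsurj ?_ hκ]
  · refine Finset.sum_eq_zero fun P hP => ?_
    have hP := mem_ncParts.1 hP
    by_cases hne : ∏ B ∈ P, κ B = 0
    · rw [hne, zero_mul]
    have hblock := fun B hB => h.balanced_and_alternating (ε := ε ∘ q) hκ (hP.nonempty B hB)
      (prod_ne_zero_iff.1 hne B hB)
    have htotal : ∑ x, labelSign (ε (q x)) = 0 :=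
      hP.sum_eq_zero _ (fun B hB => (hblock B hB).1) (subset_univ _) fun _ _ _ _ y _ _ => mem_univ y
    have heven := even_card_of_balanced hp hfib ε htotal
    rw [Fintype.card_fin] at heven
    obtain ⟨j, k, hjk, hε⟩ : ∃ j k : Fin n, (j : ℕ) + 1 = k ∧
        ε (chiPerm χ j) = ε (chiPerm χ k) := by
      simpa [IsStarAlternating] using hn heven
    have hmono := (strictMono_sideKey_chiPerm χ)
    obtain ⟨T, ⟨x, hx⟩, ⟨y, hy⟩, hconv, hT⟩ := exists_convex_union_of_blocks
      (sideKey_injective (χ ∘ q)) (sideKey_injective χ) hkl hp hfib ε hP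
      (fun B hB => (hblock B hB).1) (fun B hB => (hblock B hB).2)
      (i := chiPerm χ j) (j := chiPerm χ k) (hmono (Fin.lt_def.2 (by omega)))
      (fun c h1 h2 => by
        obtain ⟨t, rfl⟩ := (chiPerm χ).surjective c
        have h1 := Fin.lt_def.1 (hmono.lt_iff_lt.1 h1)
        have h2 := Fin.lt_def.1 (hmono.lt_iff_lt.1 h2)
        omega) hε
    have hNC := isNCPartition_pair_compl ⟨x, hx⟩ ⟨y, mem_compl.2 hy⟩ hconv
    rw [if_pos, mul_zero]
    refine ⟨hNC.toBNC, fun B hB => ?_, fun he => ?_⟩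
    · obtain ⟨z, hz⟩ := hP.nonempty B hB
      by_cases hzT : q z ∈ T
      · exact ⟨T, by simp [hNC.parts_toBNC], fun w hw => hT B hB z hz w hw hzT⟩
      · exact ⟨Tᶜ, by simp [hNC.parts_toBNC], fun w hw => mem_compl.2 fun hwT =>
          hzT (hT B hB w hw z hz hwT)⟩
    · have hu := univ_mem_parts_oneBNC (χ := χ) x
      rw [← he, hNC.parts_toBNC, mem_insert, mem_singleton] at hu
      rcases hu with hu | hu
      · exact hy (hu ▸ mem_univ y)
      · exact mem_compl.1 (hu ▸ mem_univ x) hx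
  -- The order upstairs never reverses the order of distinct indices, as `hkl` would contradict it.
  · intro x y hxy
    rw [chiLT_iff]
    rcases lt_trichotomy (sideKey χ (q x)) (sideKey χ (q y)) with hlt | heq | hgt
    · exact Or.inl hlt
    · exact Or.inr (sideKey_injective χ heq)
    · exact ((hkl _ _ hgt).not_gt hxy).elim

end Powers

end BiFree

theorem mainTheorem4 {A : Type*} [Ring A] [StarRing A] [Algebra ℂ A] [StarModule ℂ A]
    (φ : A →ₗ[ℂ] ℂ) (hφ : BiFree.IsState φ) (X Y : A)
    (hXY : BiFree.IsBiRDiagonal φ X Y) (p : ℕ) (hp : 1 ≤ p) :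
    BiFree.IsBiRDiagonal φ (X ^ p) (Y ^ p) where
  odd _ χ ε hn := hXY.pow_cumulant_eq_zero (Nat.one_le_iff_ne_zero.1 hp) χ ε
    fun he => (Nat.not_even_iff_odd.2 hn he).elim
  even _ χ ε _ halt := hXY.pow_cumulant_eq_zero (Nat.one_le_iff_ne_zero.1 hp) χ ε fun _ => halt
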